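/- Let $\mathbf F$ be a Fraïssé structure, i.e. a non-empty countable structure in a relational language such that every isomorphism between finite substructures extends to an automorphism. Let $G=\mathrm{Aut}(\mathbf F)$ with the topology of pointwise convergence ($\mathbf F$ being discrete). A $G$-flow is a continuous left action of $G$ on a compact Hausdorff space; a $G$-ambit $(X,x)$ is a $G$-flow $X$ with a point $x\in X$ whose orbit is dense. The supremum of a family $(X_\alpha,x_\alpha)_\alpha$ of ambits is the orbit closure of $(x_\alpha)_\alpha$ in $\prod_\alpha X_\alpha$ with distinguished point $(x_\alpha)_\alpha$ (for the empty family, the one-point ambit); an ambit $(Y,y)$ is a factor of $(X,x)$ if there is a continuous $G$-equivariant surjection $X\to Y$ sending $x$ to $y$. Let $\mathrm{RUC}_b(G)$ be the C$^*$-algebra, with the supremum norm, of bounded $f:G\to\mathbb C$ that are uniformly continuous for the right uniformity (with basic entourages $\{(g,h): gh^{-1}\in U\}$, $U$ a neighbourhood of $e$). $G$ acts on it by left shift, $(g\cdot f)(h)=f(g^{-1}h)$, and by right shift, $(g\bullet f)(h)=f(hg)$. The closure $\overline{G\bullet f}$ for pointwise convergence of the right-shift orbit of $f\in\mathrm{RUC}_b(G)$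 is a $G$-flow. For a finite non-empty substructure $\mathbf A$ of $\mathbf F$, write $\binom{\mathbf F}{\mathbf A}$ for the set of embeddings of $\mathbf A$ in $\mathbf F$. A finite colouring is a map $\chi:\binom{\mathbf F}{\mathbf A}\to\mathbb C$ with finite range; it is identified with the function $g\mapsto\chi(g^{-1}|_{\mathbf A})$ in $\mathrm{RUC}_b(G)$. For $\mathcal E\subset\mathrm{RUC}_b(G)$, $\mathbf F$ has the Ramsey property (resp. the Ramsey property up to $\varepsilon$) for the finite colourings in $\mathcal E$ if for all finite non-empty substructures $\mathbf A,\mathbf B$ of $\mathbf F$ and every finite set $\mathcal C\subset\mathcal E$ of finite colourings of $\binom{\mathbf F}{\mathbf A}$ there is an embedding $b$ of $\mathbf B$ in $\mathbf F$ such that every $\chi\in\mathcal C$ is constant on $\binom{b(\mathbf B)}{\mathbf A}$ (resp. takes values at distance $<\varepsilon$ at any two elements of $\binom{b(\mathbf B)}{\mathbf A}$). For $\varepsilon>0$ put $(\mathcal E)_\varepsilon=\{f\in\mathrm{RUC}_b(G):\exists a\in\mathcal E,\ \|f-a\|_\infty<\varepsilon\}$. **Theorem.** Let $\mathcal X$ be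 a class of $G$-flows such that the class of $G$-ambits whose underlying flow is in $\mathcal X$ is closed under suprema and factors, and such that every $X\in\mathcal X$ has a point $x\in X$ with $\overline{G\cdot x}\in\mathcal X$. Then $\mathcal A=\{f\in\mathrm{RUC}_b(G):\overline{G\bullet f}\in\mathcal X\}$ is a unital, left-invariant, closed C$^*$-subalgebra of $\mathrm{RUC}_b(G)$, and the following are equivalent: (i) every $G$-flow in $\mathcal X$ has a fixed point; (ii) for every $\varepsilon>0$, $\mathbf F$ has the Ramsey property up to $2\varepsilon$ for the finite colourings in $(\mathcal A)_\varepsilon$. They imply the following equivalent statements: (iii) every zero-dimensional $G$-flow in $\mathcal X$ has a fixed point; (iv) $\mathbf F$ has the Ramsey property for the finite colourings in $\mathcal A$. If the finite colourings belonging to $\mathcal A$ are dense in $\mathcal A$, then (i)–(iv) are all equivalent. -/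

import Mathlib

open Topology FirstOrder
open scoped BoundedContinuousFunction

universe u v w

namespace FlowRamsey

noncomputable section

/-! ### Flows and ambits of a topological group -/

section Flows

variable (G : Type u) [Group G] [TopologicalSpace G]

/-- A `G`-flow: a continuous left action of `G` on a compact Hausdorff space. -/
structure Flow where
  /-- The underlying space. -/
  carrier : Type u
  [topology : TopologicalSpace carrier]
  [compact : CompactSpace carrier]
  [hausdorff : T2Space carrier]
  [action : MulAction G carrier]
  [continuous_action : ContinuousSMul G carrier]

attribute [instance] Flow.topology Flow.compact Flow.hausdorff Flow.action Flow.continuous_action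

/-- A `G`-ambit: a `G`-flow with a distinguished point whose orbit is dense. -/
structure Ambit extends Flow G where
  /-- The distinguished point. -/
  pt : carrier
  dense_orbit : Dense (MulAction.orbit G pt)

variable {G}

/-- The flow has a fixed point. -/
def Flow.HasFixedPoint (X : Flow G) : Prop :=
  ∃ x : X.carrier, ∀ g : G, g • x = x

/-- The phase space has a basis of clopen sets. -/
def Flow.IsZeroDimensional (X : Flow G) : Prop :=
  TopologicalSpace.IsTopologicalBasis {s : Set X.carrier | IsClopen s}

/-- The orbit closure of `x` as an invariant subset. -/
def Flow.orbitClosureSet (X : Flow G) (x : X.carrier) : SubMulAction G X.carrier where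
  carrier := closure (MulAction.orbit G x)
  smul_mem' := by
    intro g y hy
    refine map_mem_closure (continuous_const_smul g) hy ?_
    intro z hz
    exact MulAction.mem_orbit_of_mem_orbit g hz

/-- The flow induced on the closure of the orbit of `x`. -/
def Flow.orbitClosure (X : Flow G) (x : X.carrier) : Flow G where
  carrier := X.orbitClosureSet x
  compact := isCompact_iff_compactSpace.mp (isClosed_closure (s := MulAction.orbit G x)).isCompact
  continuous_action :=
    ⟨Continuous.subtype_mk
      (continuous_fst.smul (continuous_subtype_val.comp continuous_snd)) _⟩

/-- The orbit closure of `x`, with distinguished point `x`. -/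
def Flow.orbitAmbit (X : Flow G) (x : X.carrier) : Ambit G where
  toFlow := X.orbitClosure x
  pt := ⟨x, subset_closure (MulAction.mem_orbit_self x)⟩
  dense_orbit := by
    intro y
    refine closure_subtype.2 (closure_mono ?_ y.2)
    rintro _ ⟨g, rfl⟩
    exact ⟨_, ⟨g, rfl⟩, rfl⟩

/-- The product of a family of flows, with the diagonal action. -/
def Flow.pi {ι : Type u} (X : ι → Flow G) : Flow G where
  carrier := ∀ i, (X i).carrier

/-- The supremum of a family of ambits: the orbit closure of the family of the distinguished points
in the product. For the empty family this is the one-point ambit. -/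
def Ambit.sup {ι : Type u} (X : ι → Ambit G) : Ambit G :=
  (Flow.pi fun i => (X i).toFlow).orbitAmbit fun i => (X i).pt

/-- `Y` is a factor of `X`: there is a continuous equivariant surjection from `X` onto `Y` that
respects the distinguished points. -/
def Ambit.IsFactor (Y X : Ambit G) : Prop :=
  ∃ π : X.carrier → Y.carrier, Continuous π ∧ Function.Surjective π ∧
    (∀ (g : G) (x : X.carrier), π (g • x) = g • π x) ∧ π X.pt = Y.pt

/-- The class of ambits with underlying flow in `𝒳` is closed under suprema. -/
def ClosedUnderSuprema (𝒳 : Set (Flow G)) : Prop :=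
  ∀ (ι : Type u) (X : ι → Ambit G), (∀ i, (X i).toFlow ∈ 𝒳) → (Ambit.sup X).toFlow ∈ 𝒳

/-- The class of ambits with underlying flow in `𝒳` is closed under factors. -/
def ClosedUnderFactors (𝒳 : Set (Flow G)) : Prop :=
  ∀ X Y : Ambit G, X.toFlow ∈ 𝒳 → Y.IsFactor X → Y.toFlow ∈ 𝒳

end Flows

/-! ### Right-uniformly continuous functions -/

section RUC

variable {G : Type u} [Group G] [TopologicalSpace G]

/-- Uniform continuity for the right uniformity, whose basic entourages are
`{(g, h) | g * h⁻¹ ∈ U}`, for `U` a neighbourhood of the identity. -/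
def IsRUC (f : G → ℂ) : Prop :=
  ∀ ε > 0, ∃ U ∈ 𝓝 (1 : G), ∀ g h : G, g * h⁻¹ ∈ U → dist (f g) (f h) < ε

/-- The bounded right-uniformly continuous functions. The ambient space carries the
supremum norm. -/
def RUCb (G : Type u) [Group G] [TopologicalSpace G] : Set (G →ᵇ ℂ) :=
  {f | IsRUC (f : G → ℂ)}

/-- The right shift of `f` by `g`. -/
def rightShift (g : G) (f : G → ℂ) : G → ℂ := fun h => f (h * g)

/-- The closure of the right-shift orbit of `f`, for pointwise convergence. -/
def shiftClosure (f : G → ℂ) : Set (G → ℂ) :=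
  closure (Set.range fun g : G => rightShift g f)

theorem rightShift_mem_shiftClosure (f : G → ℂ) (g : G) {φ : G → ℂ} (hφ : φ ∈ shiftClosure f) :
    rightShift g φ ∈ shiftClosure f := by
  have hc : Continuous (rightShift g : (G → ℂ) → (G → ℂ)) :=
    continuous_pi fun h => continuous_apply (h * g)
  refine map_mem_closure hc hφ ?_
  rintro _ ⟨k, rfl⟩
  refine ⟨g * k, ?_⟩
  funext h
  simp only [rightShift, mul_assoc]

instance shiftAction (f : G → ℂ) : MulAction G (shiftClosure f) where
  smul g φ := ⟨rightShift g φ.1, rightShift_mem_shiftClosure f g φ.2⟩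
  one_smul φ := Subtype.ext (funext fun h => congrArg φ.1 (mul_one h))
  mul_smul g k φ := Subtype.ext (funext fun h => congrArg φ.1 (mul_assoc h g k).symm)

theorem smul_shiftClosure_apply (f : G → ℂ) (g : G) (φ : shiftClosure f) (h : G) :
    (g • φ).1 h = φ.1 (h * g) := rfl

/-- The functions in the orbit closure of `f` share a modulus of right-uniform continuity. -/
theorem shiftClosure_equi {f : G → ℂ} (hf : IsRUC f) {ε : ℝ} (hε : 0 < ε) :
    ∃ U ∈ 𝓝 (1 : G), ∀ φ ∈ shiftClosure f, ∀ g h : G, g * h⁻¹ ∈ U → dist (φ g) (φ h) < ε := by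
  obtain ⟨U, hU, H⟩ := hf (ε / 2) (half_pos hε)
  refine ⟨U, hU, fun φ hφ g h hgh => ?_⟩
  have hcl : IsClosed {ψ : G → ℂ | dist (ψ g) (ψ h) ≤ ε / 2} :=
    isClosed_le ((continuous_apply g).dist (continuous_apply h)) continuous_const
  have hsub : shiftClosure f ⊆ {ψ : G → ℂ | dist (ψ g) (ψ h) ≤ ε / 2} := by
    refine closure_minimal ?_ hcl
    rintro _ ⟨k, rfl⟩
    refine (H (g * k) (h * k) ?_).le
    simpa [mul_assoc] using hgh
  have := hsub hφ
  simp only [Set.mem_ofPred_eq] at this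
  linarith

/-- The closure may be taken in `G → ℂ` or in the right-uniformly continuous functions. -/
theorem isRUC_of_mem_shiftClosure {f : G → ℂ} (hf : IsRUC f) {φ : G → ℂ}
    (hφ : φ ∈ shiftClosure f) : IsRUC φ := fun _ hε => by
  obtain ⟨U, hU, H⟩ := shiftClosure_equi hf hε
  exact ⟨U, hU, H φ hφ⟩

theorem isCompact_shiftClosure (f : G →ᵇ ℂ) : IsCompact (shiftClosure (f : G → ℂ)) := by
  have hK : IsCompact (Set.pi Set.univ fun _ : G => Metric.closedBall (0 : ℂ) ‖f‖) :=
    isCompact_univ_pi fun _ => isCompact_closedBall _ _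
  refine hK.of_isClosed_subset isClosed_closure (closure_minimal ?_ hK.isClosed)
  rintro _ ⟨k, rfl⟩ h -
  simpa [rightShift] using f.norm_coe_le_norm (h * k)

theorem continuousSMul_shiftClosure [IsTopologicalGroup G] {f : G → ℂ} (hf : IsRUC f) :
    ContinuousSMul G (shiftClosure f) := by
  refine ⟨Continuous.subtype_mk (continuous_pi fun h => ?_) _⟩
  rw [continuous_iff_continuousAt]
  rintro ⟨g₀, φ₀⟩
  refine Metric.tendsto_nhds.2 fun ε hε => ?_
  obtain ⟨U, hU, H⟩ := shiftClosure_equi hf (half_pos hε)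
  have h1 : ∀ᶠ p : G × shiftClosure f in 𝓝 (g₀, φ₀), (h * p.1) * (h * g₀)⁻¹ ∈ U := by
    have hc : Continuous fun p : G × shiftClosure f => (h * p.1) * (h * g₀)⁻¹ := by fun_prop
    refine hc.continuousAt.eventually_mem ?_
    simpa using hU
  have h2 : ∀ᶠ p : G × shiftClosure f in 𝓝 (g₀, φ₀),
      dist (p.2.1 (h * g₀)) (φ₀.1 (h * g₀)) < ε / 2 := by
    have hc : Continuous fun p : G × shiftClosure f => p.2.1 (h * g₀) :=
      (continuous_apply (h * g₀)).comp (continuous_subtype_val.comp continuous_snd)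
    exact Metric.tendsto_nhds.1 hc.continuousAt (ε / 2) (half_pos hε)
  filter_upwards [h1, h2] with p hp1 hp2
  calc dist (p.2.1 (h * p.1)) (φ₀.1 (h * g₀))
      ≤ dist (p.2.1 (h * p.1)) (p.2.1 (h * g₀)) + dist (p.2.1 (h * g₀)) (φ₀.1 (h * g₀)) :=
        dist_triangle _ _ _
    _ < ε := by linarith [H p.2.1 p.2.2 _ _ hp1]

/-- The flow of `G` by right shift on the pointwise closure of the orbit of a bounded
right-uniformly continuous function. -/
def shiftFlow [IsTopologicalGroup G] (f : G →ᵇ ℂ) (hf : f ∈ RUCb G) : Flow G where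
  carrier := shiftClosure (f : G → ℂ)
  compact := isCompact_iff_compactSpace.mp (isCompact_shiftClosure f)
  continuous_action := continuousSMul_shiftClosure hf

/-- The set of those `f` in `RUCb G` whose orbit closure under right shift is in `𝒳`. -/
def algebraOf [IsTopologicalGroup G] (𝒳 : Set (Flow G)) : Set (G →ᵇ ℂ) :=
  {f | ∃ hf : f ∈ RUCb G, shiftFlow f hf ∈ 𝒳}

/-- The left shift `h ↦ f (g⁻¹ * h)`. -/
def leftShift [IsTopologicalGroup G] (g : G) (f : G →ᵇ ℂ) : G →ᵇ ℂ :=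
  f.compContinuous ⟨fun h => g⁻¹ * h, continuous_const_mul g⁻¹⟩

/-- `A` is (the underlying set of) a unital, left-invariant, closed C*-subalgebra of `RUCb G`. -/
def IsLeftInvariantSubalgebra [IsTopologicalGroup G] (A : Set (G →ᵇ ℂ)) : Prop :=
  A ⊆ RUCb G ∧ (∃ S : StarSubalgebra ℂ (G →ᵇ ℂ), (S : Set (G →ᵇ ℂ)) = A) ∧ IsClosed A ∧
    ∀ (g : G), ∀ f ∈ A, leftShift g f ∈ A

/-- The open `ε`-neighbourhood of `A` in `RUCb G`, for the supremum norm. -/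
def neighbourhood (A : Set (G →ᵇ ℂ)) (ε : ℝ) : Set (G →ᵇ ℂ) :=
  {f | f ∈ RUCb G ∧ ∃ a ∈ A, ‖f - a‖ < ε}

end RUC

/-! ### The automorphism group of a structure -/

section Structures

variable (L : FirstOrder.Language.{v, w}) (F : Type u) [L.Structure F]

/-- The automorphism group of a structure. -/
abbrev Aut : Type u := F ≃[L] F

variable {L F}

instance : Group (Aut L F) where
  mul g h := g.comp h
  one := FirstOrder.Language.Equiv.refl L F
  inv g := g.symm
  mul_assoc _ _ _ := rfl
  one_mul _ := rfl
  mul_one _ := rfl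
  inv_mul_cancel g := g.symm_comp_self

theorem Aut.mul_apply (g h : Aut L F) (x : F) : (g * h) x = g (h x) := rfl

theorem Aut.one_apply (x : F) : (1 : Aut L F) x = x := rfl

theorem Aut.inv_apply_self (g : Aut L F) (x : F) : g⁻¹ (g x) = x := g.symm_apply_apply x

theorem Aut.apply_inv_self (g : Aut L F) (x : F) : g (g⁻¹ x) = x := g.apply_symm_apply x

/-- The topology of pointwise convergence, where the structure is discrete. -/
instance : TopologicalSpace (Aut L F) :=
  TopologicalSpace.induced (fun g : Aut L F => (g : F → F))
    (@Pi.topologicalSpace F (fun _ => F) fun _ => ⊥)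

theorem Aut.continuous_iff {X : Type*} [TopologicalSpace X] {k : X → Aut L F} :
    Continuous k ↔ ∀ x y : F, IsOpen {p : X | k p x = y} := by
  let _ : TopologicalSpace F := ⊥
  have : DiscreteTopology F := ⟨rfl⟩
  rw [continuous_induced_rng, continuous_pi_iff]
  refine forall_congr' fun x => ?_
  rw [continuous_discrete_rng]
  rfl

theorem Aut.isOpen_apply_eq (x y : F) : IsOpen {g : Aut L F | g x = y} :=
  Aut.continuous_iff.1 continuous_id x y

instance : IsTopologicalGroup (Aut L F) where
  continuous_mul := by
    refine Aut.continuous_iff.2 fun x y => ?_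
    have : {p : Aut L F × Aut L F | (p.1 * p.2) x = y} =
        ⋃ z : F, {g : Aut L F | g z = y} ×ˢ {g : Aut L F | g x = z} := by
      ext p
      simp [Aut.mul_apply]
    rw [this]
    exact isOpen_iUnion fun z => (Aut.isOpen_apply_eq z y).prod (Aut.isOpen_apply_eq x z)
  continuous_inv := by
    refine Aut.continuous_iff.2 fun x y => ?_
    have : {g : Aut L F | g⁻¹ x = y} = {g : Aut L F | g y = x} := by
      ext g
      constructor
      · rintro rfl
        exact g.apply_inv_self x
      · rintro rfl
        exact g.inv_apply_self y
    rw [this]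
    exact Aut.isOpen_apply_eq y x

/-! ### Colourings -/

/-- The embedding `g⁻¹|A` of the substructure `A` in `F`. -/
def restrictInv (A : L.Substructure F) (g : Aut L F) : A ↪[L] F :=
  FirstOrder.Language.Embedding.comp (g⁻¹ : Aut L F).toEmbedding A.subtype

theorem restrictInv_apply (A : L.Substructure F) (g : Aut L F) (x : A) :
    restrictInv A g x = g⁻¹ (x : F) := rfl

/-- The pointwise stabilizer of a finite substructure is a neighbourhood of the identity. -/
theorem eventually_fixes (A : L.Substructure F) [Finite A] :
    {u : Aut L F | ∀ x : A, u (x : F) = x} ∈ 𝓝 (1 : Aut L F) := by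
  have : {u : Aut L F | ∀ x : A, u (x : F) = x} = ⋂ x : A, {u : Aut L F | u (x : F) = x} := by
    ext; simp
  rw [this]
  exact (isOpen_iInter_of_finite fun x : A => Aut.isOpen_apply_eq (x : F) x).mem_nhds
    (by simp [Aut.one_apply])

theorem restrictInv_eq (A : L.Substructure F) {g h : Aut L F}
    (hu : ∀ x : A, (g * h⁻¹) (x : F) = x) : restrictInv A g = restrictInv A h := by
  ext x
  rw [restrictInv_apply, restrictInv_apply]
  conv_lhs => rw [← hu x, Aut.mul_apply, Aut.inv_apply_self]

/-- A finite colouring of the set of all embeddings of `A` in `F`. -/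
structure FiniteColouring (A : L.Substructure F) where
  /-- The colour of an embedding. -/
  colour : (A ↪[L] F) → ℂ
  finite_range : (Set.range colour).Finite

theorem isRUC_colouring (A : L.Substructure F) [Finite A] (c : (A ↪[L] F) → ℂ) :
    IsRUC fun g : Aut L F => c (restrictInv A g) := fun ε hε =>
  ⟨_, eventually_fixes A, fun g h hu => by
    have : c (restrictInv A g) = c (restrictInv A h) := congrArg c (restrictInv_eq A hu)
    simpa [this] using hε⟩

theorem IsRUC.continuous {G : Type u} [Group G] [TopologicalSpace G] [IsTopologicalGroup G]
    {f : G → ℂ} (hf : IsRUC f) : Continuous f := by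
  refine continuous_iff_continuousAt.2 fun h => Metric.tendsto_nhds.2 fun ε hε => ?_
  obtain ⟨U, hU, H⟩ := hf ε hε
  have hc : Continuous fun g : G => g * h⁻¹ := by fun_prop
  have : ∀ᶠ g in 𝓝 h, g * h⁻¹ ∈ U := hc.continuousAt.eventually_mem (by simpa using hU)
  exact this.mono fun g hg => H g h hg

/-- A finite colouring as a function `g ↦ c (g⁻¹|A)` on the automorphism group. -/
def FiniteColouring.toFun {A : L.Substructure F} [Finite A] (c : FiniteColouring A) :
    Aut L F →ᵇ ℂ :=
  BoundedContinuousFunction.mkOfBound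
    ⟨fun g => c.colour (restrictInv A g), (isRUC_colouring A c.colour).continuous⟩
    (Metric.diam (Set.range c.colour)) fun _ _ =>
      Metric.dist_le_diam_of_mem c.finite_range.isBounded ⟨_, rfl⟩ ⟨_, rfl⟩

theorem FiniteColouring.toFun_apply {A : L.Substructure F} [Finite A] (c : FiniteColouring A)
    (g : Aut L F) : c.toFun g = c.colour (restrictInv A g) := rfl

theorem FiniteColouring.toFun_mem_RUCb {A : L.Substructure F} [Finite A] (c : FiniteColouring A) :
    c.toFun ∈ RUCb (Aut L F) := isRUC_colouring A c.colour

/-- The finite colourings among the functions on the automorphism group. -/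
def finiteColourings (L : FirstOrder.Language.{v, w}) (F : Type u) [L.Structure F] :
    Set (Aut L F →ᵇ ℂ) :=
  {f | ∃ (A : L.Substructure F) (_ : Finite A) (_ : Nonempty A) (c : FiniteColouring A),
    c.toFun = f}

/-- The Ramsey property of `F` for the finite colourings in `E`. The embeddings of `A` in the copy
`b(B)` of `B` are the composites `b ∘ a`, for `a` an embedding of `A` in `B`. -/
def RamseyProperty (E : Set (Aut L F →ᵇ ℂ)) : Prop :=
  ∀ (A B : L.Substructure F) [Finite A] [Finite B] [Nonempty A] [Nonempty B]
    (C : Set (FiniteColouring A)), C.Finite → (∀ c ∈ C, c.toFun ∈ E) →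
      ∃ b : B ↪[L] F, ∀ c ∈ C, ∀ a a' : A ↪[L] B, c.colour (b.comp a) = c.colour (b.comp a')

/-- The Ramsey property of `F` up to `ε` for the finite colourings in `E`. -/
def RamseyPropertyUpTo (ε : ℝ) (E : Set (Aut L F →ᵇ ℂ)) : Prop :=
  ∀ (A B : L.Substructure F) [Finite A] [Finite B] [Nonempty A] [Nonempty B]
    (C : Set (FiniteColouring A)), C.Finite → (∀ c ∈ C, c.toFun ∈ E) →
      ∃ b : B ↪[L] F, ∀ c ∈ C, ∀ a a' : A ↪[L] B,
        dist (c.colour (b.comp a)) (c.colour (b.comp a')) < ε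

end Structures

end

end FlowRamsey

/-! Both fixed points and Ramsey properties say that, for finitely many functions `f` on the group
and a finite set `K`, some translate `K * h` makes every `f` (almost) constant on it.

For an ambit, evaluation along the dense orbit (`orbitHom`) is an isometric star-homomorphism. If
the ambit lies in `𝒳`, closure under factors puts its range inside `algebraOf 𝒳`; the supremum of
all orbit closures `shiftAmbit f` attains the whole algebra (`algebraOf_eq_range`), which gives the
C*-algebra claims. A fixed point yields translates `K * h` by density of the orbit
(`exists_almost_invariant`); conversely such translates yield a fixed point by compactness
(`hasFixedPoint_of_almost_invariant`).

By ultrahomogeneity, a copy of `B` is `h⁻¹(B)`, and the embeddings of `A` in it are restrictions of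
the `(g * h)⁻¹`; hence `ramsey_iff_shift`.

The bridge is approximation: every bounded right-uniformly continuous function is a uniform limit of
finite colourings, which may leave `algebraOf 𝒳`; this forces neighbourhoods and the error `2 * ε`.
Those of finite range are exactly finite colourings, so zero-dimensional flows need no error. -/

namespace FlowRamsey

noncomputable section

/-! ### Functions along orbits and fixed points of ambits. -/

section AmbitAlgebra

theorem shiftClosure_apply_mem_range {G : Type u} [Group G] {f : G → ℂ}
    (hf : (Set.range f).Finite) {φ : G → ℂ}
    (hφ : φ ∈ shiftClosure f) (h : G) : φ h ∈ Set.range f := by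
  refine closure_minimal (t := {ψ : G → ℂ | ψ h ∈ Set.range f}) ?_
    (hf.isClosed.preimage (continuous_apply h)) hφ
  rintro _ ⟨g, rfl⟩
  exact ⟨h * g, rfl⟩

variable {G : Type u} [Group G] [TopologicalSpace G]

/-- The functions `g ↦ φ (g • x)` are right-uniformly continuous. -/
theorem Flow.isRUC_comp_orbit (X : Flow G) (x : X.carrier) (φ : C(X.carrier, ℂ)) :
    IsRUC fun g : G => φ (g • x) := by
  intro ε hε
  -- By compactness, group elements near the identity change `φ` little at all points
  -- simultaneously.
  have h : ∀ᶠ u in 𝓝 (1 : G), ∀ y ∈ (Set.univ : Set X.carrier), dist (φ (u • y)) (φ y) < ε := by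
    refine isCompact_univ.eventually_forall_of_forall_eventually fun y _ => ?_
    have hc : Continuous fun p : G × X.carrier => dist (φ (p.1 • p.2)) (φ p.2) := by fun_prop
    exact hc.continuousAt.eventually_lt continuousAt_const (by simpa using hε)
  refine ⟨_, h, fun g k hgk => ?_⟩
  simpa [smul_smul] using hgk (k • x) trivial

/-- Evaluation of continuous functions along the orbit of `x`. -/
def Flow.orbitHom (X : Flow G) (x : X.carrier) : C(X.carrier, ℂ) →⋆ₐ[ℂ] (G →ᵇ ℂ) where
  toFun φ := (BoundedContinuousFunction.mkOfCompact φ).compContinuous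
    ⟨fun g => g • x, continuous_id.smul continuous_const⟩
  map_one' := rfl
  map_mul' _ _ := rfl
  map_zero' := rfl
  map_add' _ _ := rfl
  commutes' _ := rfl
  map_star' _ := rfl

theorem Flow.orbitHom_apply (X : Flow G) (x : X.carrier) (φ : C(X.carrier, ℂ)) (g : G) :
    X.orbitHom x φ g = φ (g • x) := rfl

/-- A bound on the dense orbit extends to the whole space. Completeness then makes the range closed.
-/
theorem Ambit.isometry_orbitHom (X : Ambit G) : Isometry (X.orbitHom X.pt) := by
  refine AddMonoidHomClass.isometry_of_norm _ fun φ => le_antisymm ?_ ?_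
  · exact (BoundedContinuousFunction.norm_le (norm_nonneg _)).2 fun g => φ.norm_coe_le_norm _
  · refine (ContinuousMap.norm_le _ (norm_nonneg _)).2 fun y => ?_
    have hcl : IsClosed {y : X.carrier | ‖φ y‖ ≤ ‖X.orbitHom X.pt φ‖} :=
      isClosed_le (by fun_prop) continuous_const
    refine closure_minimal ?_ hcl (X.dense_orbit y)
    rintro _ ⟨g, rfl⟩
    exact (X.orbitHom X.pt φ).norm_coe_le_norm g

/-- Near a fixed point, the points of the dense orbit are almost fixed. -/
theorem Ambit.exists_almost_invariant (X : Ambit G) (hX : X.HasFixedPoint)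
    {S : Set C(X.carrier, ℂ)} (hS : S.Finite) {K : Set G} (hK : K.Finite) {δ : ℝ} (hδ : 0 < δ) :
    ∃ h : G, ∀ φ ∈ S, ∀ g ∈ K, ∀ g' ∈ K,
      dist (X.orbitHom X.pt φ (g * h)) (X.orbitHom X.pt φ (g' * h)) < δ := by
  obtain ⟨z, hz⟩ := hX
  have hev : ∀ᶠ y in 𝓝 z, ∀ φ ∈ S, ∀ g ∈ K, ∀ g' ∈ K, dist (φ (g • y)) (φ (g' • y)) < δ := by
    rw [hS.eventually_all]
    intro φ _
    rw [hK.eventually_all]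
    intro g _
    rw [hK.eventually_all]
    intro g' _
    have hc : Continuous fun y : X.carrier => dist (φ (g • y)) (φ (g' • y)) := by fun_prop
    exact hc.continuousAt.eventually_lt continuousAt_const (by simpa [hz] using hδ)
  obtain ⟨_, hy, ⟨h, rfl⟩⟩ := mem_closure_iff_nhds.1 (X.dense_orbit z) _ hev
  refine ⟨h, fun φ hφ g hg g' hg' => ?_⟩
  simpa [Flow.orbitHom_apply, mul_smul] using hy φ hφ g hg g' hg'

/-- A flow with almost invariant points for a point-separating family of functions has
a fixed point. -/
theorem Flow.hasFixedPoint_of_almost_invariant (X : Flow G) (Φ : Set C(X.carrier, ℂ))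
    (hΦ : ∀ y z : X.carrier, (∀ φ ∈ Φ, φ y = φ z) → y = z)
    (H : ∀ S ⊆ Φ, S.Finite → ∀ K : Set G, K.Finite → ∀ δ > 0,
      ∃ z : X.carrier, ∀ φ ∈ S, ∀ g ∈ K, dist (φ (g • z)) (φ z) ≤ δ) : X.HasFixedPoint := by
  classical
  -- Each triple (function, group element, tolerance) imposes a closed condition; the hypothesis is
  -- the finite intersection property, with the least tolerance serving a whole finite family.
  let T : Φ × G × Set.Ioi (0 : ℝ) → Set X.carrier :=
    fun p => {z | dist (p.1.1 (p.2.1 • z)) (p.1.1 z) ≤ p.2.2.1}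
  have hT : ∀ p, IsClosed (T p) := fun p => isClosed_le (by fun_prop) continuous_const
  have hne : (⋂ p, T p).Nonempty := by
    refine CompactSpace.iInter_nonempty hT fun s => ?_
    obtain ⟨δ, hδ, hδs⟩ : ∃ δ > 0, ∀ p ∈ s, δ ≤ p.2.2.1 := by
      rcases s.eq_empty_or_nonempty with rfl | hs
      · exact ⟨1, one_pos, by simp⟩
      · obtain ⟨q, -, hq⟩ := s.exists_min_image (fun p => p.2.2.1) hs
        exact ⟨q.2.2.1, q.2.2.2, hq⟩
    obtain ⟨z, hz⟩ := H ((fun p => p.1.1) '' (s : Set (Φ × G × Set.Ioi (0 : ℝ))))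
      (by rintro _ ⟨p, -, rfl⟩; exact p.1.2) (s.finite_toSet.image _)
      ((fun p => p.2.1) '' (s : Set (Φ × G × Set.Ioi (0 : ℝ)))) (s.finite_toSet.image _) δ hδ
    refine ⟨z, Set.mem_iInter₂.2 fun p hp => ?_⟩
    exact (hz _ ⟨p, hp, rfl⟩ _ ⟨p, hp, rfl⟩).trans (hδs p hp)
  obtain ⟨z, hz⟩ := hne
  refine ⟨z, fun g => hΦ _ _ fun φ hφ => dist_le_zero.1 (le_of_forall_pos_le_add fun δ hδ => ?_)⟩
  rw [zero_add]
  exact Set.mem_iInter.1 hz (⟨φ, hφ⟩, g, ⟨δ, hδ⟩)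

theorem Flow.HasFixedPoint.of_orbitClosure {X : Flow G} {x : X.carrier}
    (h : (X.orbitClosure x).HasFixedPoint) : X.HasFixedPoint := by
  obtain ⟨z, hz⟩ := h
  exact ⟨z.1, fun g => congrArg Subtype.val (hz g)⟩

theorem Flow.IsZeroDimensional.of_separating (X : Flow G)
    (h : ∀ y z : X.carrier, y ≠ z → ∃ φ : C(X.carrier, ℂ), (Set.range φ).Finite ∧ φ y ≠ φ z) :
    X.IsZeroDimensional := by
  have : TotallySeparatedSpace X.carrier := by
    refine totallySeparatedSpace_iff_exists_isClopen.2 fun y z hyz => ?_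
    obtain ⟨φ, hφ, hne⟩ := h y z hyz
    refine ⟨φ ⁻¹' {φ y}, ⟨isClosed_singleton.preimage φ.continuous, ?_⟩, rfl, fun h => hne h.symm⟩
    have : φ ⁻¹' {φ y} = (φ ⁻¹' (Set.range φ \ {φ y}))ᶜ := by
      ext w
      simp
    rw [this]
    exact ((hφ.subset Set.sdiff_subset).isClosed.preimage φ.continuous).isOpen_compl
  exact isTopologicalBasis_isClopen

theorem Flow.IsZeroDimensional.exists_separating {X : Flow G} (hX : X.IsZeroDimensional)
    (x : X.carrier) {y z : (X.orbitClosure x).carrier} (hyz : y ≠ z) :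
    ∃ φ : C((X.orbitClosure x).carrier, ℂ), (Set.range φ).Finite ∧ φ y ≠ φ z := by
  classical
  have hne : y.1 ≠ z.1 := fun h => hyz (Subtype.ext h)
  obtain ⟨U, hU, hy, hsub⟩ := TopologicalSpace.IsTopologicalBasis.exists_subset_of_mem_open hX
    (a := y.1) (u := {z.1}ᶜ) hne isOpen_compl_singleton
  have hz : z.1 ∉ U := fun h => hsub h rfl
  have hc : Continuous (U.indicator fun _ => (1 : ℂ)) := IsClopen.continuous_indicator hU
    continuous_const
  refine ⟨⟨fun w => U.indicator (fun _ => (1 : ℂ)) w.1, hc.comp continuous_subtype_val⟩,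
    (Set.toFinite {0, 1}).subset ?_, ?_⟩
  · rintro _ ⟨w, rfl⟩
    by_cases hw : w.1 ∈ U
    · exact Or.inr (Set.indicator_of_mem (f := fun _ => (1 : ℂ)) hw)
    · exact Or.inl (Set.indicator_of_notMem (f := fun _ => (1 : ℂ)) hw)
  · change U.indicator (fun _ => (1 : ℂ)) y.1 ≠ U.indicator (fun _ => (1 : ℂ)) z.1
    rw [Set.indicator_of_mem hy, Set.indicator_of_notMem hz]
    exact one_ne_zero

/-- A fixed point in an ambit, from almost invariant translates of functions that
approximate the functions of a separating family. -/
theorem Ambit.hasFixedPoint_of_approx (X : Ambit G) (Φ : Set C(X.carrier, ℂ))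
    (hΦ : ∀ y z : X.carrier, (∀ φ ∈ Φ, φ y = φ z) → y = z)
    (H : ∀ ε > 0, ∃ E : Set (G →ᵇ ℂ),
      (∀ φ ∈ Φ, ∃ f ∈ E, ‖f - X.orbitHom X.pt φ‖ < ε) ∧
      ∀ S ⊆ E, S.Finite → ∀ K : Set G, K.Finite →
        ∃ h : G, ∀ f ∈ S, ∀ g ∈ K, ∀ g' ∈ K, dist (f (g * h)) (f (g' * h)) < 2 * ε) :
    X.HasFixedPoint := by
  refine X.hasFixedPoint_of_almost_invariant Φ hΦ fun S hS hSf K hK δ hδ => ?_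
  -- Two approximation errors `δ / 4` and the variation `2 * (δ / 4)` add up to `δ`.
  obtain ⟨E, happ, hE⟩ := H (δ / 4) (by positivity)
  choose! f hf hlt using happ
  -- Including `1` allows comparison with the point `h • X.pt` itself.
  obtain ⟨h, hh⟩ := hE (f '' S) (by rintro _ ⟨φ, hφ, rfl⟩; exact hf φ (hS hφ)) (hSf.image f)
    (insert 1 K) (hK.insert 1)
  refine ⟨h • X.pt, fun φ hφ g hg => ?_⟩
  have h1 : ∀ k, dist (φ (k • X.pt)) (f φ k) ≤ δ / 4 := fun k => by
    rw [dist_comm, ← X.toFlow.orbitHom_apply X.pt φ]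
    exact (BoundedContinuousFunction.dist_coe_le_dist k).trans
      ((dist_eq_norm _ _).trans_le (hlt φ (hS hφ)).le)
  have h2 := hh _ ⟨φ, hφ, rfl⟩ g (Set.mem_insert_of_mem _ hg) 1 (Set.mem_insert _ _)
  rw [one_mul] at h2
  have h3 := dist_triangle4_right (φ ((g * h) • X.pt)) (φ (h • X.pt)) (f φ (g * h)) (f φ h)
  rw [smul_smul]
  linarith [h1 (g * h), h1 h]

theorem Flow.eq_of_forall_continuousMap (X : Flow G) (y z : X.carrier)
    (h : ∀ φ ∈ (Set.univ : Set C(X.carrier, ℂ)), φ y = φ z) : y = z := by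
  by_contra hyz
  obtain ⟨φ, hφ⟩ := exists_continuous_zero_one_of_isClosed (isClosed_singleton (x := y))
    (isClosed_singleton (x := z)) (by simpa using hyz)
  have := h ⟨fun w => (φ w : ℂ), by fun_prop⟩ trivial
  have h0 : φ y = 0 := hφ.1 rfl
  have h1 : φ z = 1 := hφ.2.1 rfl
  simp [h0, h1] at this

/-! ### The algebra of a class of flows. -/

variable [IsTopologicalGroup G]

/-- The orbit closure of `f`, with distinguished point `f`. -/
def shiftAmbit (f : G →ᵇ ℂ) (hf : f ∈ RUCb G) : Ambit G where
  toFlow := shiftFlow f hf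
  pt := ⟨f, subset_closure ⟨1, funext fun h => congrArg f (mul_one h)⟩⟩
  dense_orbit := by
    intro y
    refine closure_subtype.2 (closure_mono ?_ y.2)
    rintro _ ⟨g, rfl⟩
    exact ⟨_, ⟨g, rfl⟩, rfl⟩

/-- The continuous function on the orbit closure of `f` that represents `f`. -/
def shiftEval (f : G →ᵇ ℂ) (hf : f ∈ RUCb G) : C((shiftFlow f hf).carrier, ℂ) :=
  ⟨fun ψ => ψ.1 1, (continuous_apply (1 : G)).comp continuous_subtype_val⟩

theorem shiftEval_smul_pt (f : G →ᵇ ℂ) (hf : f ∈ RUCb G) (g : G) :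
    shiftEval f hf (g • (shiftAmbit f hf).pt) = f g :=
  congrArg f (one_mul g)

/-- The orbit closure of `g ↦ φ (g • x)` is a factor of the ambit. -/
theorem Ambit.shiftAmbit_isFactor (X : Ambit G) (φ : C(X.carrier, ℂ))
    (hf : X.orbitHom X.pt φ ∈ RUCb G) : (shiftAmbit (X.orbitHom X.pt φ) hf).IsFactor X := by
  have hc : Continuous fun (y : X.carrier) (h : G) => φ (h • y) := by fun_prop
  have hm : ∀ y : X.carrier, (fun h : G => φ (h • y)) ∈ shiftClosure (X.orbitHom X.pt φ) := by
    intro y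
    refine map_mem_closure hc (X.dense_orbit y) ?_
    rintro _ ⟨g, rfl⟩
    refine ⟨g, funext fun h => ?_⟩
    simp [rightShift, Flow.orbitHom_apply, mul_smul]
  let π : X.carrier → (shiftAmbit (X.orbitHom X.pt φ) hf).carrier := fun y => ⟨_, hm y⟩
  have hπ : Continuous π := hc.subtype_mk hm
  have he : ∀ (g : G) (y : X.carrier), π (g • y) = g • π y := fun g y =>
    Subtype.ext (funext fun h => congrArg φ (smul_smul h g y))
  have hpt : π X.pt = (shiftAmbit (X.orbitHom X.pt φ) hf).pt := rfl
  refine ⟨π, hπ, fun w => ?_, he, hpt⟩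
  -- The image is compact, hence closed, and contains the dense orbit.
  have hw : w ∈ Set.range π := by
    refine closure_minimal ?_ (isCompact_range hπ).isClosed ((shiftAmbit _ hf).dense_orbit w)
    rintro _ ⟨g, rfl⟩
    exact ⟨g • X.pt, by rw [he, hpt]⟩
  exact hw

theorem orbitHom_mem_algebraOf {𝒳 : Set (Flow G)} (hfac : ClosedUnderFactors 𝒳) (X : Ambit G)
    (hX : X.toFlow ∈ 𝒳) (φ : C(X.carrier, ℂ)) : X.orbitHom X.pt φ ∈ algebraOf 𝒳 :=
  have hf : X.orbitHom X.pt φ ∈ RUCb G := X.isRUC_comp_orbit X.pt φ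
  ⟨hf, hfac X (shiftAmbit _ hf) hX (X.shiftAmbit_isFactor φ hf)⟩

/-- The supremum of the orbit closures of the functions in `S`. -/
def shiftSup (S : Set (G →ᵇ ℂ)) (hS : S ⊆ RUCb G) : Ambit G :=
  Ambit.sup fun f : S => shiftAmbit f.1 (hS f.2)

theorem shiftSup_mem {𝒳 : Set (Flow G)} (hsup : ClosedUnderSuprema 𝒳) {S : Set (G →ᵇ ℂ)}
    (hS : S ⊆ algebraOf 𝒳) : (shiftSup S fun _ hf => (hS hf).1).toFlow ∈ 𝒳 :=
  hsup S _ fun f => (hS f.2).2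

/-- Evaluation at the coordinate `(f, h)`. -/
def shiftSupEval (S : Set (G →ᵇ ℂ)) (hS : S ⊆ RUCb G) (f : S) (h : G) :
    C((shiftSup S hS).carrier, ℂ) :=
  ⟨fun ψ => (ψ.1 f).1 h, (continuous_apply h).comp
    (continuous_subtype_val.comp ((continuous_apply f).comp continuous_subtype_val))⟩

theorem orbitHom_shiftSupEval (S : Set (G →ᵇ ℂ)) (hS : S ⊆ RUCb G) (f : S) :
    (shiftSup S hS).orbitHom (shiftSup S hS).pt (shiftSupEval S hS f 1) = f.1 :=
  BoundedContinuousFunction.ext fun g => shiftEval_smul_pt f.1 (hS f.2) g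

/-- The supremum over the whole algebra represents each `f` by its coordinate at `(f, 1)`; closure
under factors gives the reverse inclusion. -/
theorem algebraOf_eq_range {𝒳 : Set (Flow G)} (hsup : ClosedUnderSuprema 𝒳)
    (hfac : ClosedUnderFactors 𝒳) :
    ∃ X : Ambit G, X.toFlow ∈ 𝒳 ∧ algebraOf 𝒳 = Set.range (X.orbitHom X.pt) := by
  refine ⟨_, shiftSup_mem hsup subset_rfl, Set.Subset.antisymm (fun f hf => ?_) ?_⟩
  · exact ⟨_, orbitHom_shiftSupEval (algebraOf 𝒳) _ ⟨f, hf⟩⟩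
  · rintro _ ⟨φ, rfl⟩
    exact orbitHom_mem_algebraOf hfac _ (shiftSup_mem hsup subset_rfl) φ

theorem isLeftInvariantSubalgebra_algebraOf {𝒳 : Set (Flow G)} (hsup : ClosedUnderSuprema 𝒳)
    (hfac : ClosedUnderFactors 𝒳) : IsLeftInvariantSubalgebra (algebraOf 𝒳) := by
  refine ⟨fun f hf => hf.1, ?_⟩
  obtain ⟨X, -, hX⟩ := algebraOf_eq_range hsup hfac
  rw [hX]
  refine ⟨⟨(X.orbitHom X.pt).range, rfl⟩, X.isometry_orbitHom.isClosedEmbedding.isClosed_range, ?_⟩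
  rintro g _ ⟨φ, rfl⟩
  -- Left-shifting a function along the orbit amounts to composing `φ` with the action of `g⁻¹`.
  refine ⟨φ.comp ⟨fun y => g⁻¹ • y, continuous_const_smul g⁻¹⟩, ?_⟩
  exact BoundedContinuousFunction.ext fun h => congrArg φ (smul_smul g⁻¹ h X.pt)

/-- Pointwise limits of shifts of `f` take values in the finite range of `f`, so the coordinates are
continuous functions of finite range that separate points. -/
theorem isZeroDimensional_shiftSup (S : Set (G →ᵇ ℂ)) (hS : S ⊆ RUCb G)
    (hfin : ∀ f ∈ S, (Set.range f).Finite) : (shiftSup S hS).IsZeroDimensional := by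
  refine Flow.IsZeroDimensional.of_separating _ fun y z hyz => ?_
  obtain ⟨f, hf⟩ := Function.ne_iff.1 fun h => hyz (Subtype.ext h)
  obtain ⟨h, hh⟩ := Function.ne_iff.1 fun h => hf (Subtype.ext h)
  refine ⟨shiftSupEval S hS f h, (hfin f.1 f.2).subset ?_, hh⟩
  rintro _ ⟨ψ, rfl⟩
  exact shiftClosure_apply_mem_range (hfin f.1 f.2) (ψ.1 f).2 h

/-- A fixed point of the supremum of the orbit closures of `S` gives almost invariant translates. -/
theorem exists_shift_dist_lt {S : Set (G →ᵇ ℂ)} (hSR : S ⊆ RUCb G)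
    (hfix : (shiftSup S hSR).HasFixedPoint) (hS : S.Finite) {K : Set (G)} (hK : K.Finite)
    {δ : ℝ} (hδ : 0 < δ) :
    ∃ h : G, ∀ f ∈ S, ∀ g ∈ K, ∀ g' ∈ K, dist (f (g * h)) (f (g' * h)) < δ := by
  have := hS.to_subtype
  obtain ⟨h, hh⟩ := (shiftSup S hSR).exists_almost_invariant hfix
    (Set.finite_range fun f : S => shiftSupEval S hSR f 1) hK hδ
  refine ⟨h, fun f hf g hg g' hg' => ?_⟩
  have := hh _ ⟨⟨f, hf⟩, rfl⟩ g hg g' hg'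
  rwa [orbitHom_shiftSupEval] at this

end AmbitAlgebra

/-! ### Colourings as functions on the automorphism group. -/

section Colourings

variable {L : FirstOrder.Language.{v, w}} {F : Type u} [L.Structure F]

theorem exists_automorphism_extending (hF : L.IsUltrahomogeneous F) {B : L.Substructure F}
    [Finite B] (b : B ↪[L] F) : ∃ g : Aut L F, restrictInv B g = b := by
  obtain ⟨g, hg⟩ := hF B FirstOrder.Language.Substructure.FG.of_finite b
  refine ⟨(g : Aut L F)⁻¹, ?_⟩
  rw [hg, restrictInv, inv_inv]

/-- The embeddings of `A` in the copy `h⁻¹(B)` of `B` are the restrictions of the `(g * h)⁻¹`. -/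
theorem restrictInv_comp (A B : L.Substructure F) (a : A ↪[L] B) (g h : Aut L F)
    (hg : restrictInv A g = B.subtype.comp a) :
    (restrictInv B h).comp a = restrictInv A (g * h) := by
  ext x
  have := congrArg (fun e : A ↪[L] F => h⁻¹ (e x)) hg
  simpa [restrictInv_apply, mul_inv_rev, Aut.mul_apply] using this.symm

theorem finite_embeddings (A B : L.Substructure F) [Finite A] [Finite B] : Finite (A ↪[L] B) :=
  Finite.of_injective (fun e : A ↪[L] B => (e : A → B)) DFunLike.coe_injective

/-- A colouring for `A` induces a colouring for a larger substructure, with the same function. -/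
theorem FiniteColouring.exists_of_le {A A' : L.Substructure F} [Finite A] [Finite A']
    (hle : A ≤ A') (c : FiniteColouring A) : ∃ c' : FiniteColouring A', c'.toFun = c.toFun := by
  -- An embedding of `A'` receives the colour of its restriction to `A`.
  refine ⟨⟨fun e => c.colour (e.comp (FirstOrder.Language.Substructure.inclusion hle)),
    c.finite_range.subset (Set.range_comp_subset_range _ c.colour)⟩, ?_⟩
  exact BoundedContinuousFunction.ext fun g => rfl

theorem FiniteColouring.finite_range_toFun {A : L.Substructure F} [Finite A]
    (c : FiniteColouring A) : (Set.range c.toFun).Finite :=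
  c.finite_range.subset (Set.range_comp_subset_range (restrictInv A) c.colour)

theorem finite_range_of_mem_finiteColourings {f : Aut L F →ᵇ ℂ}
    (hf : f ∈ finiteColourings L F) : (Set.range f).Finite := by
  obtain ⟨A, _, _, c, rfl⟩ := hf
  exact c.finite_range_toFun

/-- A neighbourhood of the identity contains the pointwise stabilizer of a finite set. -/
theorem exists_finite_support {U : Set (Aut L F)} (hU : U ∈ 𝓝 (1 : Aut L F)) :
    ∃ s : Set F, s.Finite ∧ ∀ g : Aut L F, (∀ x ∈ s, g x = x) → g ∈ U := by
  let _ : TopologicalSpace F := ⊥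
  have : DiscreteTopology F := ⟨rfl⟩
  obtain ⟨V, hV, hVU⟩ := mem_nhds_induced (fun g : Aut L F => (g : F → F)) 1 U |>.1 hU
  obtain ⟨W, hWV, hW, h1⟩ := mem_nhds_iff.1 hV
  obtain ⟨I, u, hu, hI⟩ := isOpen_pi_iff.1 hW _ h1
  refine ⟨I, I.finite_toSet, fun g hg => hVU (hWV (hI fun x hx => ?_))⟩
  change g x ∈ u x
  rw [hg x hx]
  exact (hu x hx).2

section Relational

variable [L.IsRelational]

theorem exists_finite_substructure {s : Set F} (hs : s.Finite) :
    ∃ A : L.Substructure F, Finite A ∧ s ⊆ A := by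
  refine ⟨FirstOrder.Language.Substructure.closure L s, ?_,
    FirstOrder.Language.Substructure.subset_closure⟩
  have : ((FirstOrder.Language.Substructure.closure L s : L.Substructure F) : Set F).Finite := by
    rwa [FirstOrder.Language.Substructure.closure_eq_of_isRelational]
  exact this

variable [Nonempty F]

/-- Finitely many finite colourings colour the embeddings of a common substructure. -/
theorem exists_common_substructure {S : Set (Aut L F →ᵇ ℂ)} (hS : S.Finite)
    (hSc : S ⊆ finiteColourings L F) :
    ∃ (A : L.Substructure F) (_ : Finite A) (_ : Nonempty A),
      ∀ f ∈ S, ∃ c : FiniteColouring A, c.toFun = f := by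
  choose A hA _ c hc using fun f : S => hSc f.2
  have := hS.to_subtype
  obtain ⟨A', hA', hsub⟩ := exists_finite_substructure (L := L)
    ((Set.finite_iUnion fun f => (hA f : (A f : Set F).Finite)).insert (Classical.arbitrary F))
  refine ⟨A', hA', ⟨⟨_, hsub (Set.mem_insert _ _)⟩⟩, fun f hf => ?_⟩
  have hle : A ⟨f, hf⟩ ≤ A' := fun x hx => hsub (Or.inr (Set.mem_iUnion_of_mem ⟨f, hf⟩ hx))
  obtain ⟨c', hc'⟩ := (c ⟨f, hf⟩).exists_of_le hle
  exact ⟨c', hc'.trans (hc ⟨f, hf⟩)⟩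

/-- The Ramsey property, for an arbitrary relation between the colours, in terms of
the functions on the automorphism group. -/
theorem ramsey_iff_shift (hF : L.IsUltrahomogeneous F) (R : ℂ → ℂ → Prop)
    (E : Set (Aut L F →ᵇ ℂ)) :
    (∀ (A B : L.Substructure F) [Finite A] [Finite B] [Nonempty A] [Nonempty B]
      (C : Set (FiniteColouring A)), C.Finite → (∀ c ∈ C, c.toFun ∈ E) →
        ∃ b : B ↪[L] F, ∀ c ∈ C, ∀ a a' : A ↪[L] B,
          R (c.colour (b.comp a)) (c.colour (b.comp a'))) ↔
    ∀ S ⊆ E ∩ finiteColourings L F, S.Finite → ∀ K : Set (Aut L F), K.Finite →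
      ∃ h : Aut L F, ∀ f ∈ S, ∀ g ∈ K, ∀ g' ∈ K, R (f (g * h)) (f (g' * h)) := by
  constructor
  · intro H S hSE hS K hK
    obtain ⟨A, _, _, hA⟩ := exists_common_substructure hS fun f hf => (hSE hf).2
    have : Nonempty (FiniteColouring A) := ⟨⟨fun _ => 0, Set.toFinite _ |>.subset
      (Set.range_const_subset (c := (0 : ℂ)))⟩⟩
    choose! c hc using hA
    -- `B` contains every `g⁻¹(A)` with `g ∈ K`, so that each `g⁻¹|A` is an embedding of `A` in `B`.
    -- The added point only ensures that `B` is non-empty.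
    obtain ⟨B, _, hB⟩ := exists_finite_substructure (L := L)
      ((hK.biUnion fun g _ => Set.finite_range (restrictInv A g)).insert (Classical.arbitrary F))
    have : Nonempty B := ⟨⟨_, hB (Set.mem_insert _ _)⟩⟩
    obtain ⟨b, hb⟩ := H A B (c '' S) (hS.image c) (by
      rintro _ ⟨f, hf, rfl⟩
      rw [hc f hf]
      exact (hSE hf).1)
    obtain ⟨h, rfl⟩ := exists_automorphism_extending hF b
    have key : ∀ g ∈ K, ∃ a : A ↪[L] B, (restrictInv B h).comp a = restrictInv A (g * h) := by
      intro g hg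
      have hmem : ∀ x, restrictInv A g x ∈ B := fun x =>
        hB (Or.inr (Set.mem_biUnion hg ⟨x, rfl⟩))
      exact ⟨FirstOrder.Language.Embedding.codRestrict B (restrictInv A g) hmem,
        restrictInv_comp A B _ g h (by ext; rfl)⟩
    refine ⟨h, fun f hf g hg g' hg' => ?_⟩
    obtain ⟨a, ha⟩ := key g hg
    obtain ⟨a', ha'⟩ := key g' hg'
    have := hb _ ⟨f, hf, rfl⟩ a a'
    rwa [ha, ha', ← FiniteColouring.toFun_apply, ← FiniteColouring.toFun_apply, hc f hf] at this
  · intro H A B _ _ _ _ C hC hCE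
    have := finite_embeddings A B
    -- Conversely, `K` consists of one automorphism for each of the finitely many embeddings of `A`
    -- in `B`.
    choose G hG using fun a : A ↪[L] B => exists_automorphism_extending hF (B.subtype.comp a)
    obtain ⟨h, hh⟩ := H (FiniteColouring.toFun '' C) (by
      rintro _ ⟨c, hc, rfl⟩
      exact ⟨hCE c hc, A, inferInstance, inferInstance, c, rfl⟩) (hC.image _) (Set.range G)
      (Set.finite_range G)
    refine ⟨restrictInv B h, fun c hc a a' => ?_⟩
    rw [restrictInv_comp A B a _ h (hG a), restrictInv_comp A B a' _ h (hG a')]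
    exact hh _ ⟨c, hc, rfl⟩ _ ⟨a, rfl⟩ _ ⟨a', rfl⟩

/-- A right-uniformly continuous function is, up to `ε`, a function of the restriction of `g⁻¹`
to a finite substructure. -/
theorem exists_restrictInv_dist_lt {f : Aut L F → ℂ} (hf : IsRUC f) {ε : ℝ} (hε : 0 < ε) :
    ∃ (A : L.Substructure F) (_ : Finite A) (_ : Nonempty A),
      ∀ g h : Aut L F, restrictInv A g = restrictInv A h → dist (f g) (f h) < ε := by
  obtain ⟨U, hU, H⟩ := hf ε hε
  obtain ⟨s, hs, hsU⟩ := exists_finite_support hU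
  obtain ⟨A, hA, hsA⟩ := exists_finite_substructure (L := L) (hs.insert (Classical.arbitrary F))
  refine ⟨A, hA, ⟨⟨_, hsA (Set.mem_insert _ _)⟩⟩, fun g h hgh => H g h (hsU _ fun x hx => ?_)⟩
  have : g⁻¹ x = h⁻¹ x :=
    congrArg (fun e : A ↪[L] F => e ⟨x, hsA (Or.inr hx)⟩) hgh
  rw [Aut.mul_apply, ← this, Aut.apply_inv_self]

/-- Up to `ε / 3`, `f g` depends only on `g⁻¹|A`; rounding its values to a finite `ε / 3`-net of the
bounded range costs another `ε / 3`. -/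
theorem exists_finiteColouring_norm_lt (hF : L.IsUltrahomogeneous F) {f : Aut L F →ᵇ ℂ}
    (hf : f ∈ RUCb (Aut L F)) {ε : ℝ} (hε : 0 < ε) :
    ∃ f' ∈ finiteColourings L F, ‖f' - f‖ < ε := by
  have h3 : 0 < ε / 3 := by positivity
  obtain ⟨A, hA, hAn, H⟩ := exists_restrictInv_dist_lt hf h3
  choose G hG using fun e : A ↪[L] F => exists_automorphism_extending hF e
  obtain ⟨t, ht, hcov⟩ := Metric.totallyBounded_iff.1 
    (f.isBounded_range.isCompact_closure.totallyBounded.subset subset_closure) _ h3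
  have hnet : ∀ g : Aut L F, ∃ y ∈ t, dist (f g) y < ε / 3 := fun g => by
    simpa using hcov (Set.mem_range_self g)
  choose N hN hNd using hnet
  let c : FiniteColouring A := ⟨fun e => N (G e), ht.subset (by rintro _ ⟨e, rfl⟩; exact hN _)⟩
  refine ⟨c.toFun, ⟨A, hA, hAn, c, rfl⟩, ?_⟩
  have : ‖c.toFun - f‖ ≤ ε / 3 + ε / 3 := by
    refine (BoundedContinuousFunction.norm_le (by positivity)).2 fun g => ?_
    rw [BoundedContinuousFunction.sub_apply, ← dist_eq_norm, dist_comm]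
    exact (dist_triangle _ (f (G (restrictInv A g))) _).trans
      (add_le_add (H _ _ (hG _).symm).le (hNd _).le)
  linarith

/-- Two distinct points of a finite set are at distance at least some `δ`. -/
theorem exists_separation {s : Set ℂ} (hs : s.Finite) :
    ∃ δ > 0, ∀ y ∈ s, ∀ z ∈ s, dist y z < δ → y = z := by
  have hev : ∀ᶠ δ in 𝓝[>] (0 : ℝ), ∀ y ∈ s, ∀ z ∈ s, dist y z < δ → y = z := by
    rw [hs.eventually_all]
    intro y _
    rw [hs.eventually_all]
    intro z _
    by_cases hyz : y = z
    · exact Filter.Eventually.of_forall fun _ _ => hyz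
    · filter_upwards [nhdsWithin_le_nhds (eventually_lt_nhds (dist_pos.2 hyz))] with δ hδ h
      exact absurd h hδ.not_gt
  obtain ⟨δ, hδ, h0⟩ := (hev.and self_mem_nhdsWithin).exists
  exact ⟨δ, h0, hδ⟩

/-- Below the gap between distinct values of `f`, approximate dependence on `g⁻¹|A` is exact
dependence. -/
theorem mem_finiteColourings_of_finite_range (hF : L.IsUltrahomogeneous F) {f : Aut L F →ᵇ ℂ}
    (hf : f ∈ RUCb (Aut L F)) (hfin : (Set.range f).Finite) : f ∈ finiteColourings L F := by
  obtain ⟨δ, hδ, hsep⟩ := exists_separation hfin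
  obtain ⟨A, hA, hAn, H⟩ := exists_restrictInv_dist_lt hf hδ
  choose G hG using fun e : A ↪[L] F => exists_automorphism_extending hF e
  refine ⟨A, hA, hAn, ⟨fun e => f (G e), hfin.subset (Set.range_comp_subset_range G f)⟩, ?_⟩
  exact BoundedContinuousFunction.ext fun g =>
    hsep _ ⟨_, rfl⟩ _ ⟨_, rfl⟩ (H _ _ (hG _))

end Relational

end Colourings

/-! ### Fixed points versus Ramsey properties. -/

section Characterisations

variable {L : FirstOrder.Language.{v, w}} [L.IsRelational] {F : Type u} [L.Structure F]
  [Nonempty F] {𝒳 : Set (Flow.{u} (Aut L F))}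

theorem ramseyPropertyUpTo_of_hasFixedPoint (hF : L.IsUltrahomogeneous F)
    (hsup : ClosedUnderSuprema 𝒳) (hfix : ∀ X ∈ 𝒳, X.HasFixedPoint) (ε : ℝ) :
    RamseyPropertyUpTo (2 * ε) (neighbourhood (algebraOf 𝒳) ε) := by
  refine (ramsey_iff_shift hF (fun y z => dist y z < 2 * ε) _).2 fun S hS hSf K hK => ?_
  choose! a ha hlt using fun f (hf : f ∈ S) => (hS hf).1.2
  -- Finiteness of `S` leaves room `δ` in the strict inequalities: variation below `2 * δ` for the
  -- approximants gives less than `2 * (ε - δ) + 2 * δ = 2 * ε` for `f`.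
  obtain ⟨δ, hδ, hδS⟩ : ∃ δ > 0, ∀ f ∈ S, ‖f - a f‖ ≤ ε - δ := by
    rcases S.eq_empty_or_nonempty with rfl | hne
    · exact ⟨1, one_pos, by simp⟩
    · obtain ⟨q, hq, hmax⟩ := S.exists_max_image (fun f => ‖f - a f‖) hSf hne
      exact ⟨ε - ‖q - a q‖, sub_pos.2 (hlt q hq), fun f hf => by simpa using hmax f hf⟩
  have hsub : a '' S ⊆ algebraOf 𝒳 := by
    rintro _ ⟨f, hf, rfl⟩
    exact ha f hf
  obtain ⟨h, hh⟩ := exists_shift_dist_lt _ (hfix _ (shiftSup_mem hsup hsub)) (hSf.image a) hK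
    (δ := 2 * δ) (by positivity)
  refine ⟨h, fun f hf g hg g' hg' => ?_⟩
  have h1 : ∀ k, dist (f k) (a f k) ≤ ε - δ := fun k =>
    (BoundedContinuousFunction.dist_coe_le_dist k).trans
      ((dist_eq_norm f (a f)).trans_le (hδS f hf))
  have h2 := hh _ ⟨f, hf, rfl⟩ g hg g' hg'
  have h3 := dist_triangle4_right (f (g * h)) (f (g' * h)) (a f (g * h)) (a f (g' * h))
  linarith [h1 (g * h), h1 (g' * h)]

theorem ramseyProperty_of_hasFixedPoint (hF : L.IsUltrahomogeneous F)
    (hsup : ClosedUnderSuprema 𝒳)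
    (hfix : ∀ X ∈ 𝒳, X.IsZeroDimensional → X.HasFixedPoint) :
    RamseyProperty (algebraOf 𝒳) := by
  refine (ramsey_iff_shift hF Eq _).2 fun S hS hSf K hK => ?_
  have hfin : ∀ f ∈ S, (Set.range f).Finite := fun f hf =>
    finite_range_of_mem_finiteColourings (hS hf).2
  -- All the colours together form a finite set, so values closer than `δ` are equal.
  obtain ⟨δ, hδ, hsep⟩ := exists_separation (hSf.biUnion hfin)
  obtain ⟨h, hh⟩ := exists_shift_dist_lt _
    (hfix _ (shiftSup_mem hsup fun f hf => (hS hf).1) (isZeroDimensional_shiftSup S _ hfin))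
    hSf hK hδ
  exact ⟨h, fun f hf g hg g' hg' => hsep _ (Set.mem_biUnion hf ⟨_, rfl⟩) _
    (Set.mem_biUnion hf ⟨_, rfl⟩) (hh f hf g hg g' hg')⟩

theorem hasFixedPoint_of_ramseyPropertyUpTo (hF : L.IsUltrahomogeneous F)
    (hfac : ClosedUnderFactors 𝒳) (horb : ∀ X ∈ 𝒳, ∃ x : X.carrier, X.orbitClosure x ∈ 𝒳)
    (hR : ∀ ε : ℝ, 0 < ε → RamseyPropertyUpTo (2 * ε) (neighbourhood (algebraOf 𝒳) ε)) :
    ∀ X ∈ 𝒳, X.HasFixedPoint := by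
  intro X hX
  obtain ⟨x, hx⟩ := horb X hX
  refine Flow.HasFixedPoint.of_orbitClosure (x := x) ?_
  refine (X.orbitAmbit x).hasFixedPoint_of_approx Set.univ
    (Flow.eq_of_forall_continuousMap _) fun ε hε => ⟨_, fun φ _ => ?_,
      (ramsey_iff_shift hF (fun y z => dist y z < 2 * ε) _).1 (hR ε hε)⟩
  have hmem := orbitHom_mem_algebraOf hfac (X.orbitAmbit x) hx φ
  -- The approximating colouring need not lie in `algebraOf 𝒳`, only in its `ε`-neighbourhood.
  obtain ⟨f, hf, hlt⟩ := exists_finiteColouring_norm_lt hF hmem.1 hε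
  obtain ⟨A, _, _, c, rfl⟩ := hf
  exact ⟨c.toFun, ⟨⟨c.toFun_mem_RUCb, _, hmem, hlt⟩, A, inferInstance, inferInstance, c, rfl⟩, hlt⟩

/-- Density supplies approximating colourings inside `algebraOf 𝒳`, to which the exact Ramsey
property applies. -/
theorem hasFixedPoint_of_ramseyProperty_of_dense (hF : L.IsUltrahomogeneous F)
    (hfac : ClosedUnderFactors 𝒳) (horb : ∀ X ∈ 𝒳, ∃ x : X.carrier, X.orbitClosure x ∈ 𝒳)
    (hR : RamseyProperty (algebraOf 𝒳))
    (hd : algebraOf 𝒳 ⊆ closure (algebraOf 𝒳 ∩ finiteColourings L F)) :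
    ∀ X ∈ 𝒳, X.HasFixedPoint := by
  intro X hX
  obtain ⟨x, hx⟩ := horb X hX
  refine Flow.HasFixedPoint.of_orbitClosure (x := x) ?_
  refine (X.orbitAmbit x).hasFixedPoint_of_approx Set.univ
    (Flow.eq_of_forall_continuousMap _) fun ε hε =>
      ⟨algebraOf 𝒳 ∩ finiteColourings L F, fun φ _ => ?_, fun S hS hSf K hK => ?_⟩
  · obtain ⟨f, hf, hlt⟩ := Metric.mem_closure_iff.1
      (hd (orbitHom_mem_algebraOf hfac (X.orbitAmbit x) hx φ)) ε hε
    exact ⟨f, hf, by rwa [← dist_eq_norm, dist_comm]⟩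
  · obtain ⟨h, hh⟩ := (ramsey_iff_shift hF Eq _).1 hR S hS hSf K hK
    exact ⟨h, fun f hf g hg g' hg' => by
      rw [hh f hf g hg g' hg', dist_self]
      positivity⟩

/-- Finite-range functions separate the points of the orbit closure, and along the orbit they
already are finite colourings in `algebraOf 𝒳`. -/
theorem hasFixedPoint_of_ramseyProperty (hF : L.IsUltrahomogeneous F)
    (hfac : ClosedUnderFactors 𝒳) (horb : ∀ X ∈ 𝒳, ∃ x : X.carrier, X.orbitClosure x ∈ 𝒳)
    (hR : RamseyProperty (algebraOf 𝒳)) :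
    ∀ X ∈ 𝒳, X.IsZeroDimensional → X.HasFixedPoint := by
  intro X hX hX0
  obtain ⟨x, hx⟩ := horb X hX
  refine Flow.HasFixedPoint.of_orbitClosure (x := x) ?_
  refine (X.orbitAmbit x).hasFixedPoint_of_approx {φ | (Set.range φ).Finite} (fun y z hyz => ?_)
    fun ε hε => ⟨algebraOf 𝒳 ∩ finiteColourings L F, fun φ hφ => ?_, fun S hS hSf K hK => ?_⟩
  · by_contra hne
    obtain ⟨φ, hφ, hφ'⟩ := hX0.exists_separating x hne
    exact hφ' (hyz φ hφ)
  · have hmem := orbitHom_mem_algebraOf hfac (X.orbitAmbit x) hx φ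
    refine ⟨_, ⟨hmem, mem_finiteColourings_of_finite_range hF hmem.1 ?_⟩, by simpa using hε⟩
    exact Set.Finite.subset hφ
      (Set.range_comp_subset_range (fun g : Aut L F => g • (X.orbitAmbit x).pt) φ)
  · obtain ⟨h, hh⟩ := (ramsey_iff_shift hF Eq _).1 hR S hS hSf K hK
    exact ⟨h, fun f hf g hg g' hg' => by
      rw [hh f hf g hg g' hg', dist_self]
      positivity⟩

end Characterisations

end

end FlowRamsey

theorem theorem2 (L : FirstOrder.Language.{v, w}) [L.IsRelational]
    (F : Type u) [L.Structure F] [Nonempty F] [Countable F] (hF : L.IsUltrahomogeneous F)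
    (𝒳 : Set (FlowRamsey.Flow.{u} (FlowRamsey.Aut L F)))
    (hsup : FlowRamsey.ClosedUnderSuprema 𝒳)
    (hfac : FlowRamsey.ClosedUnderFactors 𝒳)
    (horb : ∀ X ∈ 𝒳, ∃ x : X.carrier, X.orbitClosure x ∈ 𝒳) :
    FlowRamsey.IsLeftInvariantSubalgebra (FlowRamsey.algebraOf 𝒳) ∧
    -- (i) and (ii) are equivalent
    ((∀ X ∈ 𝒳, X.HasFixedPoint) ↔
      ∀ ε : ℝ, 0 < ε → FlowRamsey.RamseyPropertyUpTo (2 * ε)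
        (FlowRamsey.neighbourhood (FlowRamsey.algebraOf 𝒳) ε)) ∧
    -- (iii) and (iv) are equivalent
    ((∀ X ∈ 𝒳, X.IsZeroDimensional → X.HasFixedPoint) ↔
      FlowRamsey.RamseyProperty (FlowRamsey.algebraOf 𝒳)) ∧
    -- (i) implies (iii)
    ((∀ X ∈ 𝒳, X.HasFixedPoint) → ∀ X ∈ 𝒳, X.IsZeroDimensional → X.HasFixedPoint) ∧
    -- all four are equivalent when the finite colourings are dense
    (FlowRamsey.algebraOf 𝒳 ⊆
        closure (FlowRamsey.algebraOf 𝒳 ∩ FlowRamsey.finiteColourings L F) →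
      [∀ X ∈ 𝒳, X.HasFixedPoint,
        ∀ ε : ℝ, 0 < ε → FlowRamsey.RamseyPropertyUpTo (2 * ε)
          (FlowRamsey.neighbourhood (FlowRamsey.algebraOf 𝒳) ε),
        ∀ X ∈ 𝒳, X.IsZeroDimensional → X.HasFixedPoint,
        FlowRamsey.RamseyProperty (FlowRamsey.algebraOf 𝒳)].TFAE) := by
  have h12 := Iff.intro
    (fun h (ε : ℝ) (_ : 0 < ε) => FlowRamsey.ramseyPropertyUpTo_of_hasFixedPoint hF hsup h ε)
    (FlowRamsey.hasFixedPoint_of_ramseyPropertyUpTo hF hfac horb)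
  have h34 := Iff.intro (FlowRamsey.ramseyProperty_of_hasFixedPoint hF hsup)
    (FlowRamsey.hasFixedPoint_of_ramseyProperty hF hfac horb)
  refine ⟨FlowRamsey.isLeftInvariantSubalgebra_algebraOf hsup hfac, h12, h34,
    fun h X hX _ => h X hX, fun hd => ?_⟩
  tfae_have 1 ↔ 2 := h12
  tfae_have 3 ↔ 4 := h34
  tfae_have 1 → 3 := fun h X hX _ => h X hX
  tfae_have 4 → 1 := fun h =>
    FlowRamsey.hasFixedPoint_of_ramseyProperty_of_dense hF hfac horb h hd
  tfae_finish
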